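/- There is an absolute constant $K>0$ such that the following holds. Let $X$ be a measurable space of items with measurable subsets $P_1,\dots,P_d\subseteq X$ (properties) and measurable values $v_i(c)\in[0,1]$ for $c\in P_i$. Let $D$ be a probability distribution on $X$ such that $\Pr_{c\sim D}[v_i(c)=x\mid c\in P_i]=0$ for every $x\in[0,1]$ and every $i$ with $\Pr_{c\sim D}[c\in P_i]>0$. Let $k_1,\dots,k_d\ge 0$ be integers with $k=\sum_i k_i\ge 2$, let $n\ge 0$ be an integer and $\delta\in(0,1)$. A thresholds-policy is a vector $T=(t_1,\dots,t_d)\in\mathbb{R}^d$; it retains an item $c$ if and only if there is an $i$ with $c\in P_i$ and $v_i(c)\ge t_i$. For a sample $C=(c_1,\dots,c_n)$ let $V^T(C)$ be the maximum of $\sum_{i=1}^d\sum_{c\in S_i}v_i(c)$ over all pairwise disjoint $S_1,\dots,S_d$ with $|S_i|=k_i$ such that every element of $S_i$ is either an item of $C$ that is retained by $T$ and lies in $P_i$, or one of $k$ additional dummy items, which have all properties with value $0$ and are always available. (Different draws of the sample count as different items.) Let $\nu^T=\mathbb{E}_{C\sim D^n}[V^T(C)]$; this expectation is well defined. Then with probability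 at least $1-\delta$ over $C\sim D^n$, simultaneously for all thresholds-policies $T$, $$\bigl|\nu^T-V^T(C)\bigr|\le \epsilon k,\qquad \epsilon=K\sqrt{\frac{d\log k+\log(1/\delta)}{k}} .$$ -/

import Mathlib

open MeasureTheory ProbabilityTheory

namespace ThresholdSelection

/-- The item `c` is retained by the thresholds-policy `T = (t₁, …, t_d)`: it has some property `P i`
and its value for that property passes the threshold `T i`. -/
def IsRetained {X : Type*} {d : ℕ} (P : Fin d → Set X) (v : Fin d → X → ℝ) (T : Fin d → ℝ)
    (c : X) : Prop :=
  ∃ i, c ∈ P i ∧ T i ≤ v i c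

/-- For a sample `C` of `n` items, the items that can be selected are indexed by `Fin n ⊕ Fin k`:
`Sum.inl j` is the item `C j`, and `Sum.inr l` is one of `k` dummy items. Dummy items have all the
properties. -/
def HasProperty {X : Type*} {d n k : ℕ} (P : Fin d → Set X) (C : Fin n → X) (i : Fin d) :
    Fin n ⊕ Fin k → Prop
  | Sum.inl j => C j ∈ P i
  | Sum.inr _ => True

/-- The value of a (sample or dummy) item for property `i`; dummy items have value `0`. -/
def itemValue {X : Type*} {d n k : ℕ} (v : Fin d → X → ℝ) (C : Fin n → X) (i : Fin d) :
    Fin n ⊕ Fin k → ℝ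
  | Sum.inl j => v i (C j)
  | Sum.inr _ => 0

/-- `S = (S₁, …, S_d)` is a feasible solution that uses, besides the `k = ∑ i, κ i` dummy items,
only those items of the sample `C` whose index lies in `A`: the sets `S i` are pairwise disjoint,
`S i` has exactly `κ i` elements, and all of them have property `P i`. -/
structure IsFeasible {X : Type*} {d n : ℕ} (P : Fin d → Set X) (κ : Fin d → ℕ) (C : Fin n → X)
    (A : Set (Fin n)) (S : Fin d → Finset (Fin n ⊕ Fin (∑ i, κ i))) : Prop where
  disjoint : ∀ i i', i ≠ i' → Disjoint (S i) (S i')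
  card_eq : ∀ i, (S i).card = κ i
  hasProperty : ∀ i, ∀ x ∈ S i, HasProperty P C i x
  available : ∀ i j, Sum.inl j ∈ S i → j ∈ A

/-- The total value of a solution. -/
def solutionValue {X : Type*} {d n k : ℕ} (v : Fin d → X → ℝ) (C : Fin n → X)
    (S : Fin d → Finset (Fin n ⊕ Fin k)) : ℝ :=
  ∑ i, ∑ x ∈ S i, itemValue v C i x

/-- The values of all the feasible solutions that use only dummy items and sample items in `A`. -/
def feasibleValues {X : Type*} {d n : ℕ} (P : Fin d → Set X) (v : Fin d → X → ℝ)
    (κ : Fin d → ℕ) (C : Fin n → X) (A : Set (Fin n)) : Set ℝ :=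
  {w | ∃ S, IsFeasible P κ C A S ∧ solutionValue v C S = w}

/-- The value of an optimal solution (a maximum, see `isGreatest_optValue`). -/
noncomputable def optValue {X : Type*} {d n : ℕ} (P : Fin d → Set X) (v : Fin d → X → ℝ)
    (κ : Fin d → ℕ) (C : Fin n → X) (A : Set (Fin n)) : ℝ :=
  sSup (feasibleValues P v κ C A)

theorem feasibleValues_nonempty {X : Type*} {d n : ℕ} (P : Fin d → Set X) (v : Fin d → X → ℝ)
    (κ : Fin d → ℕ) (C : Fin n → X) (A : Set (Fin n)) : (feasibleValues P v κ C A).Nonempty := by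
  classical
  refine ⟨_, fun i => Finset.univ.image
    (fun j : Fin (κ i) => Sum.inr (finSigmaFinEquiv ⟨i, j⟩)), ⟨?_, ?_, ?_, ?_⟩, rfl⟩
  · intro i i' h
    rw [Finset.disjoint_left]
    intro x hx hx'
    simp only [Finset.mem_image, Finset.mem_univ, true_and] at hx hx'
    obtain ⟨j, rfl⟩ := hx
    obtain ⟨j', hj⟩ := hx'
    have := finSigmaFinEquiv.injective (Sum.inr.inj hj)
    exact h (congrArg Sigma.fst this).symm
  · intro i
    rw [Finset.card_image_of_injective, Finset.card_univ, Fintype.card_fin]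
    intro j j' h
    have := finSigmaFinEquiv.injective (Sum.inr.inj h)
    simpa using this
  · intro i x hx
    simp only [Finset.mem_image, Finset.mem_univ, true_and] at hx
    obtain ⟨j, rfl⟩ := hx
    trivial
  · intro i j h
    simp at h

theorem feasibleValues_finite {X : Type*} {d n : ℕ} (P : Fin d → Set X) (v : Fin d → X → ℝ)
    (κ : Fin d → ℕ) (C : Fin n → X) (A : Set (Fin n)) : (feasibleValues P v κ C A).Finite :=
  (Set.finite_range (solutionValue v C)).subset fun _ ⟨S, _, h⟩ => ⟨S, h⟩

/-- An optimal solution exists and `optValue` is its value. -/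
theorem isGreatest_optValue {X : Type*} {d n : ℕ} (P : Fin d → Set X) (v : Fin d → X → ℝ)
    (κ : Fin d → ℕ) (C : Fin n → X) (A : Set (Fin n)) :
    IsGreatest (feasibleValues P v κ C A) (optValue P v κ C A) :=
  ⟨(feasibleValues_nonempty P v κ C A).csSup_mem (feasibleValues_finite P v κ C A),
    fun _ h => le_csSup (feasibleValues_finite P v κ C A).bddAbove h⟩

/-- `V^T(C)`: the value of an optimal solution among the items of `C` retained by `T`. -/
noncomputable def policyValue {X : Type*} {d n : ℕ} (P : Fin d → Set X) (v : Fin d → X → ℝ)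
    (κ : Fin d → ℕ) (T : Fin d → ℝ) (C : Fin n → X) : ℝ :=
  optValue P v κ C {j | IsRetained P v T (C j)}

/-- `D^n`: the law of a sample of `n` independent draws from `D`. -/
noncomputable def sampleLaw {X : Type*} [MeasurableSpace X] (D : Measure X) (n : ℕ) :
    Measure (Fin n → X) :=
  Measure.pi fun _ => D

/-- `ν^T`: the expectation of `V^T(C)` for `C ∼ D^n`. -/
noncomputable def expectedPolicyValue {X : Type*} [MeasurableSpace X] {d : ℕ} (D : Measure X)
    (n : ℕ) (P : Fin d → Set X) (v : Fin d → X → ℝ) (κ : Fin d → ℕ) (T : Fin d → ℝ) : ℝ :=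
  ∫ C, policyValue P v κ T C ∂(sampleLaw D n)

end ThresholdSelection

/-! An optimal solution is a maximum-weight assignment of items to `k` slots, so its value is a
submodular function of the set of available items (`optValue_union_add_inter_le`); it is also
monotone, and one extra item adds at most 1. Submodularity is used twice.

Concentration for one policy: the items are revealed one at a time. By submodularity, the expected
marginal gain of a new item is at most its gain on top of the items already revealed, and these
gains telescope to at most `k`. Hence the quadratic compensator in the exponential moment is
governed by `k` and not by `n` (`IsSubmodularFunctional.integral_exp_le_one`), and deviations of
size `s ≤ 2k` have probability at most `2 exp(-s²/(16k))`.

Uniformity over policies: moving several thresholds changes the value by at most the sum of the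
changes made by moving each one while the other properties retain nothing (`policyValue_sub_le`).
Without atoms each one-property expectation is continuous, so `k + 1` thresholds per property
bracket it with steps at most 1. The grid of at most `(k+1)^d` policies is fixed before the sample
is drawn, and monotonicity extends its bounds to all policies at a cost of `d`
(`exists_policy_net`). A union bound over the grid finishes the proof. -/

namespace ThresholdSelection

/-! ### Submodularity of the optimal assignment value. -/

section Combinatorics

variable {X : Type*} {d n : ℕ} {P : Fin d → Set X} {v : Fin d → X → ℝ} {κ : Fin d → ℕ}
  {C : Fin n → X}

/-- A solution in slot form: an injective assignment of available items to the `κ i` slots of each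
property `i`. -/
structure IsSlotSolution (P : Fin d → Set X) (κ : Fin d → ℕ) (C : Fin n → X) (A : Set (Fin n))
    (m : (Σ i, Fin (κ i)) → Fin n ⊕ Fin (∑ i, κ i)) : Prop where
  injective : Function.Injective m
  hasProperty : ∀ s, HasProperty P C s.1 (m s)
  available : ∀ s j, m s = Sum.inl j → j ∈ A

theorem IsSlotSolution.mem_feasibleValues {A : Set (Fin n)}
    {m : (Σ i, Fin (κ i)) → Fin n ⊕ Fin (∑ i, κ i)} (hm : IsSlotSolution P κ C A m) :
    ∑ s, itemValue v C s.1 (m s) ∈ feasibleValues P v κ C A := by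
  classical
  have inj : ∀ i, Function.Injective fun j : Fin (κ i) => m ⟨i, j⟩ := fun i j j' h => by
    simpa using hm.injective h
  refine ⟨fun i => Finset.univ.image fun j : Fin (κ i) => m ⟨i, j⟩, ⟨?_, ?_, ?_, ?_⟩, ?_⟩
  · intro i i' h
    rw [Finset.disjoint_left]
    intro x hx hx'
    simp only [Finset.mem_image, Finset.mem_univ, true_and] at hx hx'
    obtain ⟨j, rfl⟩ := hx
    obtain ⟨j', hj⟩ := hx'
    exact h (congrArg Sigma.fst (hm.injective hj)).symm
  · intro i
    rw [Finset.card_image_of_injective _ (inj i), Finset.card_univ, Fintype.card_fin]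
  · intro i x hx
    simp only [Finset.mem_image, Finset.mem_univ, true_and] at hx
    obtain ⟨j, rfl⟩ := hx
    exact hm.hasProperty ⟨i, j⟩
  · intro i j h
    simp only [Finset.mem_image, Finset.mem_univ, true_and] at h
    obtain ⟨j', h⟩ := h
    exact hm.available _ _ h
  · rw [solutionValue, Fintype.sum_sigma]
    refine Finset.sum_congr rfl fun i _ => ?_
    rw [Finset.sum_image fun j _ j' _ h => inj i h]

theorem exists_isSlotSolution {A : Set (Fin n)} {w : ℝ} (hw : w ∈ feasibleValues P v κ C A) :
    ∃ m, IsSlotSolution P κ C A m ∧ ∑ s, itemValue v C s.1 (m s) = w := by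
  classical
  obtain ⟨S, hS, rfl⟩ := hw
  let e : ∀ i, Fin (κ i) ≃ S i := fun i => ((S i).equivFinOfCardEq (hS.card_eq i)).symm
  refine ⟨fun s => e s.1 s.2, ⟨?_, ?_, ?_⟩, ?_⟩
  · rintro ⟨i, j⟩ ⟨i', j'⟩ h
    have hi : i = i' := by
      by_contra hne
      exact Finset.disjoint_left.1 (hS.disjoint i i' hne) (e i j).2
        (by rw [show ((e i j : S i) : Fin n ⊕ Fin (∑ i, κ i)) = e i' j' from h]; exact (e i' j').2)
    subst hi
    exact congrArg (Sigma.mk i) ((e i).injective (Subtype.ext h))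
  · rintro ⟨i, j⟩
    exact hS.hasProperty i _ (e i j).2
  · rintro ⟨i, j⟩ j' h
    exact hS.available i j' (by rw [← h]; exact (e i j).2)
  · rw [solutionValue, Fintype.sum_sigma]
    refine Finset.sum_congr rfl fun i _ => ?_
    rw [← Finset.sum_coe_sort (S i)]
    exact (e i).sum_comp fun x : S i => itemValue v C i x.1

theorem IsSlotSolution.le_optValue {A : Set (Fin n)}
    {m : (Σ i, Fin (κ i)) → Fin n ⊕ Fin (∑ i, κ i)} (hm : IsSlotSolution P κ C A m) :
    ∑ s, itemValue v C s.1 (m s) ≤ optValue P v κ C A :=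
  (isGreatest_optValue P v κ C A).2 hm.mem_feasibleValues

theorem exists_isSlotSolution_eq_optValue (P : Fin d → Set X) (v : Fin d → X → ℝ) (κ : Fin d → ℕ)
    (C : Fin n → X) (A : Set (Fin n)) :
    ∃ m, IsSlotSolution P κ C A m ∧ ∑ s, itemValue v C s.1 (m s) = optValue P v κ C A :=
  exists_isSlotSolution (isGreatest_optValue P v κ C A).1

/-- The optimal value is submodular in the set of available items. -/
theorem optValue_union_add_inter_le (P : Fin d → Set X) (v : Fin d → X → ℝ) (κ : Fin d → ℕ)
    (C : Fin n → X) (A B : Set (Fin n)) :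
    optValue P v κ C (A ∪ B) + optValue P v κ C (A ∩ B) ≤
      optValue P v κ C A + optValue P v κ C B := by
  classical
  obtain ⟨m₁, h₁, e₁⟩ := exists_isSlotSolution_eq_optValue P v κ C (A ∪ B)
  obtain ⟨m₀, h₀, e₀⟩ := exists_isSlotSolution_eq_optValue P v κ C (A ∩ B)
  -- Exchange along alternating paths: `R` links the slot of an item under `m₁` to its slot under
  -- `m₀`, and `U` collects the slots on paths ending at an item of `A \ B`. Swapping `m₁` and `m₀`
  -- off `U` moves all of `A \ B` into one solution, and each slot keeps its two items, so the total
  -- value is preserved.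
  let R : (Σ i, Fin (κ i)) → (Σ i, Fin (κ i)) → Prop := fun s s' => m₁ s = m₀ s'
  let U : Set (Σ i, Fin (κ i)) :=
    {s | ∃ r, (∃ j ∈ A \ B, m₁ r = Sum.inl j) ∧ Relation.ReflTransGen R s r}
  have back : ∀ s s', R s s' → s' ∈ U → s ∈ U := fun s s' h ⟨r, hr, hs⟩ =>
    ⟨r, hr, Relation.ReflTransGen.head h hs⟩
  -- Paths do not branch, since `m₀` is injective, and a terminal slot has no successor, since `m₀`
  -- avoids `A \ B`. Closure of `U` in both directions is what makes the mixed assignments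
  -- injective.
  have forth : ∀ s s', R s s' → s ∈ U → s' ∈ U := by
    rintro s s' h ⟨r, hr, hs⟩
    rcases Relation.ReflTransGen.cases_head hs with rfl | ⟨s'', h', hs'⟩
    · obtain ⟨j, hj, hr⟩ := hr
      exact absurd (h₀.available s' j (h.symm.trans hr)).2 hj.2
    · have : s' = s'' := h₀.injective (h.symm.trans h')
      exact this ▸ ⟨r, hr, hs'⟩
  let m : (Σ i, Fin (κ i)) → Fin n ⊕ Fin (∑ i, κ i) := fun s => if s ∈ U then m₁ s else m₀ s
  let m' : (Σ i, Fin (κ i)) → Fin n ⊕ Fin (∑ i, κ i) := fun s => if s ∈ U then m₀ s else m₁ s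
  have hm : IsSlotSolution P κ C A m := by
    refine ⟨?_, ?_, ?_⟩
    · intro s s' h
      by_cases hs : s ∈ U <;> by_cases hs' : s' ∈ U <;> simp only [m, hs, hs', if_true, if_false] at h
      · exact h₁.injective h
      · exact absurd (forth s s' h hs) hs'
      · exact absurd (forth s' s h.symm hs') hs
      · exact h₀.injective h
    · intro s
      by_cases hs : s ∈ U <;> simp only [m, hs, if_true, if_false]
      exacts [h₁.hasProperty s, h₀.hasProperty s]
    · intro s j h
      by_cases hs : s ∈ U <;> simp only [m, hs, if_true, if_false] at h
      · obtain ⟨r, ⟨j', hj', hr⟩, hsr⟩ := hs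
        rcases Relation.ReflTransGen.cases_head hsr with rfl | ⟨s'', h', -⟩
        · rw [h] at hr
          exact (Sum.inl.inj hr) ▸ hj'.1
        · exact (h₀.available s'' j (h'.symm.trans h)).1
      · exact (h₀.available s j h).1
  have hm' : IsSlotSolution P κ C B m' := by
    refine ⟨?_, ?_, ?_⟩
    · intro s s' h
      by_cases hs : s ∈ U <;> by_cases hs' : s' ∈ U <;>
        simp only [m', hs, hs', if_true, if_false] at h
      · exact h₀.injective h
      · exact absurd (back s' s h.symm hs) hs'
      · exact absurd (back s s' h hs') hs
      · exact h₁.injective h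
    · intro s
      by_cases hs : s ∈ U <;> simp only [m', hs, if_true, if_false]
      exacts [h₀.hasProperty s, h₁.hasProperty s]
    · intro s j h
      by_cases hs : s ∈ U <;> simp only [m', hs, if_true, if_false] at h
      · exact (h₀.available s j h).2
      · by_contra hj
        exact hs ⟨s, ⟨j, ⟨(h₁.available s j h).resolve_right hj, hj⟩, h⟩, .refl⟩
  have hsum : ∑ s, itemValue v C s.1 (m₁ s) + ∑ s, itemValue v C s.1 (m₀ s) =
      ∑ s, itemValue v C s.1 (m s) + ∑ s, itemValue v C s.1 (m' s) := by
    rw [← Finset.sum_add_distrib, ← Finset.sum_add_distrib]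
    refine Finset.sum_congr rfl fun s _ => ?_
    by_cases hs : s ∈ U <;> simp only [m, m', hs, if_true, if_false]
    exact add_comm _ _
  rw [← e₁, ← e₀, hsum]
  exact add_le_add hm.le_optValue hm'.le_optValue

theorem optValue_mono (P : Fin d → Set X) (v : Fin d → X → ℝ) (κ : Fin d → ℕ) (C : Fin n → X) :
    Monotone (optValue P v κ C) := by
  intro A B h
  obtain ⟨m, hm, e⟩ := exists_isSlotSolution_eq_optValue P v κ C A
  rw [← e]
  exact (IsSlotSolution.mk hm.injective hm.hasProperty
    fun s j hs => h (hm.available s j hs)).le_optValue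

theorem itemValue_mem_Icc {k : ℕ} (hv : ∀ i, ∀ c ∈ P i, v i c ∈ Set.Icc (0 : ℝ) 1) {i : Fin d}
    {x : Fin n ⊕ Fin k} (hx : HasProperty P C i x) : itemValue v C i x ∈ Set.Icc (0 : ℝ) 1 := by
  rcases x with j | l
  · exact hv i _ hx
  · simp [itemValue]

theorem optValue_mem_Icc (hv : ∀ i, ∀ c ∈ P i, v i c ∈ Set.Icc (0 : ℝ) 1) (κ : Fin d → ℕ)
    (C : Fin n → X) (A : Set (Fin n)) :
    optValue P v κ C A ∈ Set.Icc (0 : ℝ) (∑ i, κ i : ℕ) := by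
  obtain ⟨m, hm, e⟩ := exists_isSlotSolution_eq_optValue P v κ C A
  rw [← e]
  refine ⟨Finset.sum_nonneg fun s _ => (itemValue_mem_Icc hv (hm.hasProperty s)).1, ?_⟩
  refine (Finset.sum_le_sum fun s _ => (itemValue_mem_Icc hv (hm.hasProperty s)).2).trans ?_
  simp

theorem optValue_singleton_le_one (hv : ∀ i, ∀ c ∈ P i, v i c ∈ Set.Icc (0 : ℝ) 1)
    (κ : Fin d → ℕ) (C : Fin n → X) (j : Fin n) : optValue P v κ C {j} ≤ 1 := by
  classical
  obtain ⟨m, hm, e⟩ := exists_isSlotSolution_eq_optValue P v κ C {j}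
  rw [← e]
  have key : ∀ s, m s ≠ Sum.inl j → itemValue v C s.1 (m s) = 0 := by
    intro s hs
    rcases h : m s with j' | l
    · have : j' = j := hm.available s j' h
      exact absurd (this ▸ h) hs
    · rfl
  by_cases hex : ∃ s, m s = Sum.inl j
  · obtain ⟨s, hs⟩ := hex
    rw [Finset.sum_eq_single s]
    · exact (itemValue_mem_Icc hv (hm.hasProperty s)).2
    · exact fun s' _ hne => key s' fun h => hne (hm.injective (h.trans hs.symm))
    · simp
  · push Not at hex
    rw [Finset.sum_eq_zero fun s _ => key s (hex s)]
    exact zero_le_one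

theorem optValue_insert_le (hv : ∀ i, ∀ c ∈ P i, v i c ∈ Set.Icc (0 : ℝ) 1) (κ : Fin d → ℕ)
    (C : Fin n → X) (A : Set (Fin n)) (j : Fin n) :
    optValue P v κ C (insert j A) ≤ optValue P v κ C A + 1 := by
  have h := optValue_union_add_inter_le P v κ C {j} A
  rw [Set.singleton_union] at h
  linarith [optValue_singleton_le_one hv κ C j, (optValue_mem_Icc hv κ C ({j} ∩ A)).1]

theorem optValue_congr (P : Fin d → Set X) (v : Fin d → X → ℝ) (κ : Fin d → ℕ)
    {C C' : Fin n → X} {A : Set (Fin n)} (h : ∀ j ∈ A, C j = C' j) :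
    optValue P v κ C A = optValue P v κ C' A := by
  have key : ∀ {C C' : Fin n → X}, (∀ j ∈ A, C j = C' j) →
      optValue P v κ C A ≤ optValue P v κ C' A := by
    intro C C' h
    obtain ⟨m, hm, e⟩ := exists_isSlotSolution_eq_optValue P v κ C A
    have hm' : IsSlotSolution P κ C' A m := by
      refine ⟨hm.injective, fun s => ?_, hm.available⟩
      have := hm.hasProperty s
      rcases hs : m s with j | l
      · rw [hs] at this
        change C' j ∈ P s.1
        rw [← h j (hm.available s j hs)]
        exact this
      · trivial
    rw [← e]
    refine le_trans (le_of_eq (Finset.sum_congr rfl fun s _ => ?_)) hm'.le_optValue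
    rcases hs : m s with j | l
    · exact congrArg (v s.1) (h j (hm.available s j hs))
    · rfl
  exact le_antisymm (key h) (key fun j hj => (h j hj).symm)

/-- The value of an optimal solution among the retained items whose index lies in `A`. -/
noncomputable def partialValue (P : Fin d → Set X) (v : Fin d → X → ℝ) (κ : Fin d → ℕ)
    (T : Fin d → ℝ) (C : Fin n → X) (A : Set (Fin n)) : ℝ :=
  optValue P v κ C (A ∩ {j | IsRetained P v T (C j)})

theorem partialValue_univ (P : Fin d → Set X) (v : Fin d → X → ℝ) (κ : Fin d → ℕ)
    (T : Fin d → ℝ) (C : Fin n → X) :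
    partialValue P v κ T C Set.univ = policyValue P v κ T C := by
  rw [partialValue, Set.univ_inter, policyValue]

theorem policyValue_mem_Icc (hv : ∀ i, ∀ c ∈ P i, v i c ∈ Set.Icc (0 : ℝ) 1) (κ : Fin d → ℕ)
    (T : Fin d → ℝ) (C : Fin n → X) :
    policyValue P v κ T C ∈ Set.Icc (0 : ℝ) (∑ i, κ i : ℕ) :=
  optValue_mem_Icc hv κ C _

theorem policyValue_antitone (P : Fin d → Set X) (v : Fin d → X → ℝ) (κ : Fin d → ℕ)
    (C : Fin n → X) : Antitone fun T => policyValue P v κ T C := fun _ _ h =>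
  optValue_mono P v κ C fun _ ⟨i, hi, ht⟩ => ⟨i, hi, (h i).trans ht⟩

/-- Diminishing returns: enlarging `U i` to `L i` gains less when other elements are already
present. The enlargements are made one index at a time. -/
theorem sub_iUnion_le_sum_sub {ι α : Type*} {f : Set α → ℝ}
    (hf : ∀ A B, f (A ∪ B) + f (A ∩ B) ≤ f A + f B) (hmono : Monotone f) {L U : ι → Set α}
    (hUL : ∀ i, U i ⊆ L i) (I : Finset ι) :
    f (⋃ i ∈ I, L i) - f (⋃ i ∈ I, U i) ≤ ∑ i ∈ I, (f (L i) - f (U i)) := by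
  classical
  have dim : ∀ {U L : Set α} (B : Set α), U ⊆ L → f (L ∪ B) + f U ≤ f L + f (U ∪ B) := by
    intro U L B h
    have h1 := hf L (U ∪ B)
    rw [← Set.union_assoc, Set.union_eq_self_of_subset_right h] at h1
    have h2 : f U ≤ f (L ∩ (U ∪ B)) := hmono (Set.subset_inter h Set.subset_union_left)
    linarith
  induction I using Finset.induction_on with
  | empty => simp
  | insert a I ha ih =>
    rw [Finset.sum_insert ha, Finset.set_biUnion_insert, Finset.set_biUnion_insert]
    have h1 := dim (⋃ i ∈ I, U i) (hUL a)
    have h2 := dim (L a) (Set.iUnion₂_mono fun i (_ : i ∈ I) => hUL i)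
    rw [Set.union_comm _ (L a), Set.union_comm _ (L a)] at h2
    linarith

/-- Changing all the thresholds costs at most the sum of the costs of changing each one while no
item is retained for the other properties. -/
theorem policyValue_sub_le (hv : ∀ i, ∀ c ∈ P i, v i c ∈ Set.Icc (0 : ℝ) 1) (κ : Fin d → ℕ)
    (C : Fin n → X) {T T' : Fin d → ℝ} (h : T ≤ T') :
    policyValue P v κ T C - policyValue P v κ T' C ≤
      ∑ i, (policyValue P v κ (Function.update (fun _ => 2) i (T i)) C -
        policyValue P v κ (Function.update (fun _ => 2) i (T' i)) C) := by
  have hall : ∀ T : Fin d → ℝ, {j | IsRetained P v T (C j)} =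
      ⋃ i ∈ Finset.univ, {j | C j ∈ P i ∧ T i ≤ v i (C j)} := fun T => by
    ext j; simp [IsRetained]
  -- Values are at most 1, so threshold 2 switches a property off.
  have hone : ∀ i t, {j | IsRetained P v (Function.update (fun _ => 2) i t) (C j)} =
      {j | C j ∈ P i ∧ t ≤ v i (C j)} := by
    intro i t
    ext j
    refine ⟨?_, fun h => ⟨i, h.1, by simpa using h.2⟩⟩
    rintro ⟨i', hi', ht⟩
    by_cases hii : i' = i
    · subst hii
      exact ⟨hi', by simpa using ht⟩
    · rw [Function.update_of_ne hii] at ht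
      linarith [(hv i' _ hi').2]
  simp only [policyValue, hone]
  rw [hall T, hall T']
  exact sub_iUnion_le_sum_sub (optValue_union_add_inter_le P v κ C) (optValue_mono P v κ C)
    (fun i j (hj : C j ∈ P i ∧ T' i ≤ v i (C j)) => show C j ∈ P i ∧ T i ≤ v i (C j) from
      ⟨hj.1, (h i).trans hj.2⟩) Finset.univ

theorem policyValue_clip (hv : ∀ i, ∀ c ∈ P i, v i c ∈ Set.Icc (0 : ℝ) 1) (κ : Fin d → ℕ)
    (T : Fin d → ℝ) (C : Fin n → X) :
    policyValue P v κ (fun i => max 0 (min 2 (T i))) C = policyValue P v κ T C := by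
  have : {j | IsRetained P v (fun i => max 0 (min 2 (T i))) (C j)} =
      {j | IsRetained P v T (C j)} := by
    ext j
    refine exists_congr fun i => and_congr_right fun hi => ?_
    have h := hv i _ hi
    simp only [max_le_iff, min_le_iff, h.1, true_and]
    exact or_iff_right (by linarith [h.2])
  simp only [policyValue, this]

end Combinatorics

/-! ### Exponential concentration for submodular functionals of independent items. -/

section Concentration

variable {X : Type*} [MeasurableSpace X] {D : Measure X} [IsProbabilityMeasure D]

theorem integrable_of_abs_le {Ω : Type*} [MeasurableSpace Ω] {μ : Measure Ω} [IsFiniteMeasure μ]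
    {f : Ω → ℝ} (hf : Measurable f) {B : ℝ} (hB : ∀ x, |f x| ≤ B) : Integrable f μ :=
  Integrable.of_bound hf.aestronglyMeasurable B (ae_of_all _ hB)

/-- One step of the supermartingale, with `e` the mean of `h`. Apply `exp x ≤ 1 + x + x²`: since `h²
≤ h ≤ G ≤ 1` and `16 l² ≤ 1`, the term `-4l²G` absorbs both `2l²h²` and the square of the
compensator. What remains integrates to `1 - 2l²e²`. -/
theorem integral_exp_sub_mul_le_one {h G : X → ℝ} (hh : Measurable h) (hG : Measurable G)
    (h0 : ∀ c, 0 ≤ h c) (hle : ∀ c, h c ≤ G c) (hG1 : ∀ c, G c ≤ 1) {l : ℝ} (hl : |l| ≤ 1 / 4) :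
    ∫ c, Real.exp (l * (h c - ∫ c, h c ∂D) - 4 * l ^ 2 * G c) ∂D ≤ 1 := by
  have hint : Integrable h D := integrable_of_abs_le hh (B := 1) fun c =>
    abs_le.2 ⟨by linarith [h0 c], (hle c).trans (hG1 c)⟩
  set e := ∫ c, h c ∂D with he
  have e0 : 0 ≤ e := integral_nonneg h0
  have e1 : e ≤ 1 := by
    have := integral_mono hint (integrable_const (1 : ℝ)) fun c => (hle c).trans (hG1 c)
    simpa using this
  have hl2 : l ^ 2 ≤ 1 / 16 := by
    rw [← sq_abs]; nlinarith [abs_nonneg l]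
  have bound : ∀ c, Real.exp (l * (h c - e) - 4 * l ^ 2 * G c) ≤
      1 + l * (h c - e) + 2 * l ^ 2 * (e ^ 2 - 2 * h c * e) := by
    intro c
    have hG0 := (h0 c).trans (hle c)
    have hd : |l * (h c - e)| ≤ 1 / 4 := by
      rw [abs_mul]
      have : |h c - e| ≤ 1 := abs_le.2 ⟨by linarith [h0 c], by linarith [hle c, hG1 c]⟩
      calc |l| * |h c - e| ≤ 1 / 4 * 1 := by gcongr
        _ = 1 / 4 := by norm_num
    have hq0 : 0 ≤ 4 * l ^ 2 * G c := by positivity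
    have hq1 : 4 * l ^ 2 * G c ≤ 1 / 4 := by nlinarith [sq_nonneg l, hG1 c]
    have hx : |l * (h c - e) - 4 * l ^ 2 * G c| ≤ 1 := by
      rw [abs_le] at hd ⊢; constructor <;> linarith
    have hexp := (abs_le.1 (Real.abs_exp_sub_one_sub_id_le hx)).2
    have hsq : (l * (h c - e) - 4 * l ^ 2 * G c) ^ 2 ≤
        2 * (l * (h c - e)) ^ 2 + 2 * (4 * l ^ 2 * G c) ^ 2 := by
      nlinarith [sq_nonneg (l * (h c - e) + 4 * l ^ 2 * G c)]
    have hsq1 : (4 * l ^ 2 * G c) ^ 2 ≤ l ^ 2 * G c := by nlinarith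
    have hh2 : l ^ 2 * (h c) ^ 2 ≤ l ^ 2 * G c := by
      have : (h c) ^ 2 ≤ G c := by nlinarith [h0 c, hle c, hG1 c]
      gcongr
    nlinarith
  have hint' : Integrable
      (fun c => 1 + l * (h c - e) + 2 * l ^ 2 * (e ^ 2 - 2 * h c * e)) D := by fun_prop
  have hexpint : Integrable (fun c => Real.exp (l * (h c - e) - 4 * l ^ 2 * G c)) D :=
    hint'.mono' (by fun_prop) (ae_of_all _ fun c => by
      rw [Real.norm_eq_abs, Real.abs_exp]; exact bound c)
  refine (integral_mono hexpint hint' bound).trans ?_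
  have : (fun c => 1 + l * (h c - e) + 2 * l ^ 2 * (e ^ 2 - 2 * h c * e)) =
      fun c => (1 - l * e + 2 * l ^ 2 * e ^ 2) + (l - 4 * l ^ 2 * e) * h c := by
    ext c; ring
  rw [this, integral_add (integrable_const _) (hint.const_mul _), integral_const_mul, ← he]
  simp only [integral_const, probReal_univ, one_smul]
  nlinarith [mul_nonneg (sq_nonneg l) (sq_nonneg e)]

/-- A bounded measurable function of a sample `C` and of a set `A` of indices that depends only on
the sample items with index in `A`, and that is monotone, submodular and `1`-Lipschitz in `A`. -/
structure IsSubmodularFunctional {n : ℕ} (B : ℝ) (F : (Fin n → X) → Set (Fin n) → ℝ) : Prop where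
  measurable : ∀ A, Measurable fun C => F C A
  bound : ∀ C A, |F C A| ≤ B
  mono : ∀ C, Monotone (F C)
  union_add_inter_le : ∀ C A A', F C (A ∪ A') + F C (A ∩ A') ≤ F C A + F C A'
  insert_le : ∀ C A j, F C (insert j A) ≤ F C A + 1
  congr : ∀ C C' A, (∀ j ∈ A, C j = C' j) → F C A = F C' A

theorem integral_pi_succ {n : ℕ} {f : (Fin (n + 1) → X) → ℝ}
    (hf : Integrable f (Measure.pi fun _ => D)) :
    ∫ C, f C ∂(Measure.pi fun _ => D) =
      ∫ c, ∫ C, f (Fin.cons c C) ∂(Measure.pi fun _ : Fin n => D) ∂D := by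
  have hmp := (measurePreserving_piFinSuccAbove (fun _ : Fin (n + 1) => D) 0).symm
  rw [← hmp.integral_comp' (g := f)]
  rw [integral_prod]
  · simp [MeasurableEquiv.piFinSuccAbove, Fin.insertNthEquiv]
  · exact hmp.integrable_comp_of_integrable hf

theorem measurable_cons {n : ℕ} :
    Measurable fun p : X × (Fin n → X) => (Fin.cons p.1 p.2 : Fin (n + 1) → X) := by
  refine measurable_pi_lambda _ fun j => ?_
  refine Fin.cases ?_ (fun j => ?_) j
  · simpa using measurable_fst
  · simpa [Function.comp_def] using (measurable_pi_apply j).comp measurable_snd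

/-- Fixing the first item and keeping it always available preserves the structure; this is the
functional that the induction on `n` is applied to. -/
theorem IsSubmodularFunctional.cons {n : ℕ} {B : ℝ} {F : (Fin (n + 1) → X) → Set (Fin (n + 1)) → ℝ}
    (hF : IsSubmodularFunctional B F) (c : X) :
    IsSubmodularFunctional B fun (C : Fin n → X) A =>
      F (Fin.cons c C) (insert 0 (Fin.succ '' A)) where
  measurable A := (hF.measurable _).comp (measurable_cons.comp measurable_prodMk_left)
  bound C A := hF.bound _ _
  mono C A A' h := hF.mono _ (Set.insert_subset_insert (Set.image_mono h))
  union_add_inter_le C A A' := by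
    have := hF.union_add_inter_le (Fin.cons c C) (insert 0 (Fin.succ '' A))
      (insert 0 (Fin.succ '' A'))
    rwa [← Set.insert_union_distrib, ← Set.insert_inter_distrib, ← Set.image_union,
      ← Set.image_inter (Fin.succ_injective n)] at this
  insert_le C A j := by
    rw [Set.image_insert_eq, Set.insert_comm]
    exact hF.insert_le _ _ _
  congr C C' A h := by
    refine hF.congr _ _ _ ?_
    rintro j (rfl | ⟨j, hj, rfl⟩)
    · rfl
    · simpa using h j hj

/-- Subtracting the random increment `F C univ - F C ∅` makes the induction close: conditioning on
the first item splits it into that item's own gain `G` and the increment of the conditioned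
functional, whose baseline is `{0}`. -/
theorem IsSubmodularFunctional.integral_exp_le_one {n : ℕ} {B : ℝ}
    {F : (Fin n → X) → Set (Fin n) → ℝ} (hF : IsSubmodularFunctional B F) {l : ℝ}
    (hl : |l| ≤ 1 / 4) :
    ∫ C, Real.exp (l * (F C Set.univ - ∫ C, F C Set.univ ∂(Measure.pi fun _ => D))
      - 4 * l ^ 2 * (F C Set.univ - F C ∅)) ∂(Measure.pi fun _ => D) ≤ 1 := by
  induction n with
  | zero =>
    have huniv : (Set.univ : Set (Fin 0)) = ∅ := Set.eq_empty_of_isEmpty _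
    have hconst : ∀ C, F C ∅ = F Fin.elim0 ∅ := fun C => hF.congr _ _ _ (by simp)
    simp [huniv, hconst]
  | succ n ih =>
    let μ : Measure (Fin n → X) := Measure.pi fun _ => D
    have hmeas : ∀ A, Measurable fun p : X × (Fin n → X) => F (Fin.cons p.1 p.2) A := fun A =>
      (hF.measurable A).comp measurable_cons
    have hmeasc : ∀ A c, Measurable fun C : Fin n → X => F (Fin.cons c C) A := fun A c =>
      (hF.measurable A).comp (measurable_cons.comp measurable_prodMk_left)
    have hint : ∀ A c, Integrable (fun C : Fin n → X => F (Fin.cons c C) A) μ := fun A c =>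
      integrable_of_abs_le (hmeasc A c) fun C => hF.bound _ _
    let m : X → ℝ := fun c => ∫ C, F (Fin.cons c C) Set.univ ∂μ
    have hm : Measurable m :=
      (hmeas Set.univ).stronglyMeasurable.integral_prod_right.measurable
    let x₀ : X := Classical.choice D.nonempty_of_neZero
    let C₀ : Fin n → X := fun _ => x₀
    let e₀ : ℝ := F (fun _ => x₀) ∅
    have he₀ : ∀ C, F C ∅ = e₀ := fun C => hF.congr _ _ _ (by simp)
    -- The gain of the first item over the empty set sees only `c`, so the filler `C₀` is arbitrary.
    let G : X → ℝ := fun c => F (Fin.cons c C₀) {0} - e₀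
    have hG : ∀ c (C : Fin n → X), F (Fin.cons c C) {0} = G c + e₀ := by
      intro c C
      simp only [G, sub_add_cancel]
      exact hF.congr _ _ _ (by simp)
    have hGm : Measurable G :=
      ((hF.measurable {0}).comp (measurable_cons.comp measurable_prodMk_right)).sub_const _
    -- The mean value without the first item. Thus `h` is the expected marginal gain of that item
    -- over all the others, and submodularity gives `h ≤ G`.
    let q : ℝ := ∫ C, F (Fin.cons x₀ C) (Set.range Fin.succ) ∂μ
    let h : X → ℝ := fun c => m c - q
    have hq : ∀ c, q = ∫ C, F (Fin.cons c C) (Set.range Fin.succ) ∂μ := by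
      intro c
      refine integral_congr_ae (ae_of_all _ fun C => hF.congr _ _ _ ?_)
      rintro j ⟨j, rfl⟩
      simp
    have hh : ∀ c, h c = ∫ C, (F (Fin.cons c C) Set.univ -
        F (Fin.cons c C) (Set.range Fin.succ)) ∂μ := by
      intro c
      rw [integral_sub (hint _ c) (hint _ c), ← hq c]
    have hsplit : insert 0 (Set.range (Fin.succ : Fin n → Fin (n + 1))) = Set.univ := by
      ext j
      refine Fin.cases ?_ (fun j => ?_) j <;> simp
    have hh0 : ∀ c, 0 ≤ h c := by
      intro c
      rw [hh c]
      exact integral_nonneg fun C => sub_nonneg.2 (hF.mono _ (Set.subset_univ _))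
    have hhG : ∀ c, h c ≤ G c := by
      intro c
      rw [hh c]
      have : ∀ C : Fin n → X, F (Fin.cons c C) Set.univ -
          F (Fin.cons c C) (Set.range Fin.succ) ≤ G c := by
        intro C
        have := hF.union_add_inter_le (Fin.cons c C) {0} (Set.range Fin.succ)
        rw [Set.singleton_union, hsplit, hG c C, Set.singleton_inter_eq_empty.2 (by simp),
          he₀] at this
        linarith
      have := integral_mono ((hint _ c).sub (hint _ c)) (integrable_const (μ := μ) (G c)) this
      simpa using this
    have hG1 : ∀ c, G c ≤ 1 := by
      intro c
      have := hF.insert_le (Fin.cons c C₀) ∅ 0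
      rw [insert_empty_eq, he₀] at this
      linarith
    have hmB : ∀ c, |m c| ≤ B := by
      intro c
      have := norm_integral_le_of_norm_le_const (μ := μ) (f := fun C => F (Fin.cons c C) Set.univ)
        (C := B) (ae_of_all _ fun C => hF.bound _ _)
      simpa using this
    have hmean : ∫ C, F C Set.univ ∂(Measure.pi fun _ : Fin (n + 1) => D) = ∫ c, m c ∂D :=
      integral_pi_succ (integrable_of_abs_le (hF.measurable _) fun C => hF.bound _ _)
    have hmh : ∀ c, m c - ∫ c, m c ∂D = h c - ∫ c, h c ∂D := by
      intro c
      have : ∫ c, h c ∂D = ∫ c, m c ∂D - q := by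
        rw [integral_sub (integrable_of_abs_le hm hmB) (integrable_const _)]
        simp
      rw [this]
      simp only [h]
      ring
    rw [hmean]
    set M := ∫ c, m c ∂D with hM
    have hBB : ∀ C : Fin (n + 1) → X, ‖Real.exp (l * (F C Set.univ - M)
        - 4 * l ^ 2 * (F C Set.univ - F C ∅))‖ ≤
        Real.exp (|l| * (B + |M|) + 4 * l ^ 2 * (B + B)) := by
      intro C
      rw [Real.norm_eq_abs, Real.abs_exp, Real.exp_le_exp]
      have h1 := hF.bound C Set.univ
      have h2 := hF.bound C ∅
      have h3 : l * (F C Set.univ - M) ≤ |l| * (B + |M|) := by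
        refine (le_abs_self _).trans ?_
        rw [abs_mul]
        gcongr
        exact (abs_sub _ _).trans (by gcongr)
      have h4 : -(4 * l ^ 2 * (F C Set.univ - F C ∅)) ≤ 4 * l ^ 2 * (B + B) := by
        rw [← mul_neg]
        gcongr
        linarith [(abs_le.1 h1).1, (abs_le.1 h2).2]
      linarith
    have hmeasexp : Measurable fun C : Fin (n + 1) → X =>
        Real.exp (l * (F C Set.univ - M) - 4 * l ^ 2 * (F C Set.univ - F C ∅)) := by
      have h1 := hF.measurable Set.univ
      have h2 := hF.measurable ∅
      fun_prop
    rw [integral_pi_succ (Integrable.of_bound hmeasexp.aestronglyMeasurable _ (ae_of_all _ hBB))]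
    refine le_trans ?_ (integral_exp_sub_mul_le_one (D := D) (hm.sub_const q) hGm hh0 hhG hG1 hl)
    refine integral_mono_of_nonneg (ae_of_all _ fun c => integral_nonneg fun C => by positivity)
      ?_ (ae_of_all _ fun c => ?_)
    · have hb : ∀ c, |h c - ∫ c, h c ∂D| ≤ B + |M| := fun c => by
        rw [← hmh]; exact (abs_sub _ _).trans (add_le_add_left (hmB c) _)
      refine Integrable.of_bound (by fun_prop) (Real.exp (|l| * (B + |M|))) (ae_of_all _ fun c => ?_)
      rw [Real.norm_eq_abs, Real.abs_exp, Real.exp_le_exp]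
      have h1 : 0 ≤ 4 * l ^ 2 * G c := mul_nonneg (by positivity) ((hh0 c).trans (hhG c))
      have h2 : l * (h c - ∫ c, h c ∂D) ≤ |l| * (B + |M|) := by
        refine (le_abs_self _).trans ?_
        rw [abs_mul]
        exact mul_le_mul_of_nonneg_left (hb c) (abs_nonneg l)
      simp only [h] at h2 ⊢
      linarith
    · have hc := ih (hF.cons c)
      simp only [Set.image_univ, hsplit, Set.image_empty, insert_empty_eq] at hc
      change ∫ C, Real.exp (l * (F (Fin.cons c C) Set.univ - M) - 4 * l ^ 2 *
        (F (Fin.cons c C) Set.univ - F (Fin.cons c C) ∅)) ∂μ ≤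
        Real.exp (l * (h c - ∫ c, h c ∂D) - 4 * l ^ 2 * G c)
      have hfac : ∀ C : Fin n → X, Real.exp (l * (F (Fin.cons c C) Set.univ - M) - 4 * l ^ 2 *
          (F (Fin.cons c C) Set.univ - F (Fin.cons c C) ∅)) =
          Real.exp (l * (h c - ∫ c, h c ∂D) - 4 * l ^ 2 * G c) *
          Real.exp (l * (F (Fin.cons c C) Set.univ - m c) - 4 * l ^ 2 *
            (F (Fin.cons c C) Set.univ - F (Fin.cons c C) {0})) := by
        intro C
        rw [← Real.exp_add, he₀, hG c C, ← hmh c]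
        congr 1
        ring
      simp only [hfac]
      rw [integral_const_mul]
      exact mul_le_of_le_one_right (Real.exp_pos _).le hc

/-- Two-sided tail bound for a submodular functional whose total increment is at most `k`. -/
theorem IsSubmodularFunctional.measure_abs_sub_ge_le {n : ℕ} {B : ℝ}
    {F : (Fin n → X) → Set (Fin n) → ℝ} (hF : IsSubmodularFunctional B F) {k : ℝ} (hk : 0 < k)
    (hFk : ∀ C, F C Set.univ - F C ∅ ≤ k) {s : ℝ} (hs : 0 ≤ s) (hsk : s ≤ 2 * k) :
    (Measure.pi fun _ : Fin n => D).real
      {C | s ≤ |(∫ C, F C Set.univ ∂(Measure.pi fun _ => D)) - F C Set.univ|} ≤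
      2 * Real.exp (-(s ^ 2 / (16 * k))) := by
  set μ : Measure (Fin n → X) := Measure.pi fun _ => D
  set M := ∫ C, F C Set.univ ∂μ
  have hM := hF.measurable Set.univ
  have hE := hF.measurable ∅
  have tail : ∀ l : ℝ, |l| ≤ 1 / 4 → ∀ a : ℝ,
      μ.real {C | a ≤ l * (F C Set.univ - M)} ≤ Real.exp (4 * l ^ 2 * k - a) := by
    intro l hl a
    have hint : Integrable (fun C => Real.exp (l * (F C Set.univ - M)
        - 4 * l ^ 2 * (F C Set.univ - F C ∅))) μ := by
      refine Integrable.of_bound (by fun_prop) (Real.exp (|l| * (B + |M|)))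
        (ae_of_all _ fun C => ?_)
      rw [Real.norm_eq_abs, Real.abs_exp, Real.exp_le_exp]
      have h1 : 0 ≤ 4 * l ^ 2 * (F C Set.univ - F C ∅) :=
        mul_nonneg (by positivity) (sub_nonneg.2 (hF.mono C (Set.empty_subset _)))
      have h2 : l * (F C Set.univ - M) ≤ |l| * (B + |M|) := by
        refine (le_abs_self _).trans ?_
        rw [abs_mul]
        exact mul_le_mul_of_nonneg_left
          ((abs_sub _ _).trans (add_le_add_left (hF.bound _ _) _)) (abs_nonneg l)
      linarith
    have hmarkov := mul_meas_ge_le_integral_of_nonneg (ae_of_all _ fun C => (Real.exp_pos _).le)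
      hint (Real.exp (a - 4 * l ^ 2 * k))
    have hsub : {C | a ≤ l * (F C Set.univ - M)} ⊆ {C | Real.exp (a - 4 * l ^ 2 * k) ≤
        Real.exp (l * (F C Set.univ - M) - 4 * l ^ 2 * (F C Set.univ - F C ∅))} := by
      intro C hC
      simp only [Set.mem_ofPred_eq, Real.exp_le_exp] at hC ⊢
      have : 4 * l ^ 2 * (F C Set.univ - F C ∅) ≤ 4 * l ^ 2 * k := by
        have := hFk C
        gcongr
      linarith
    have h1 := measureReal_mono (μ := μ) hsub
    have h2 := hF.integral_exp_le_one (D := D) hl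
    have h3 : Real.exp (4 * l ^ 2 * k - a) * Real.exp (a - 4 * l ^ 2 * k) = 1 := by
      rw [← Real.exp_add]; simp
    have h4 : Real.exp (a - 4 * l ^ 2 * k) * μ.real {C | a ≤ l * (F C Set.univ - M)} ≤ 1 :=
      (mul_le_mul_of_nonneg_left h1 (Real.exp_pos _).le).trans (hmarkov.trans h2)
    calc μ.real {C | a ≤ l * (F C Set.univ - M)}
        = Real.exp (4 * l ^ 2 * k - a) *
          (Real.exp (a - 4 * l ^ 2 * k) * μ.real {C | a ≤ l * (F C Set.univ - M)}) := by
          rw [← mul_assoc, h3, one_mul]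
      _ ≤ Real.exp (4 * l ^ 2 * k - a) * 1 := by gcongr
      _ = _ := mul_one _
  -- Minimizer of `4 l² k - l s`; the assumption `s ≤ 2k` is exactly `l ≤ 1/4`.
  set l := s / (8 * k) with hldef
  have hl0 : 0 ≤ l := by positivity
  have hl : |l| ≤ 1 / 4 := by
    rw [abs_of_nonneg hl0, hldef, div_le_iff₀ (by positivity)]
    linarith
  have hval : 4 * l ^ 2 * k - l * s = -(s ^ 2 / (16 * k)) := by
    rw [hldef]; field_simp; ring
  have hup := tail l hl (l * s)
  have hlo := tail (-l) (by rwa [abs_neg]) (l * s)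
  rw [neg_sq, hval] at hlo
  rw [hval] at hup
  have hsub : {C | s ≤ |M - F C Set.univ|} ⊆
      {C | l * s ≤ l * (F C Set.univ - M)} ∪ {C | l * s ≤ -l * (F C Set.univ - M)} := by
    intro C hC
    rcases le_abs.1 (show s ≤ |M - F C Set.univ| from hC) with h | h
    · right
      change l * s ≤ -l * (F C Set.univ - M)
      nlinarith
    · left
      change l * s ≤ l * (F C Set.univ - M)
      nlinarith
  calc μ.real {C | s ≤ |M - F C Set.univ|} ≤ _ := measureReal_mono hsub
    _ ≤ _ := measureReal_union_le _ _
    _ ≤ _ := add_le_add hup hlo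
    _ = _ := by ring

end Concentration

/-! ### Measurability, tails and continuity for threshold policies. -/

section Policies

variable {X : Type*} [MeasurableSpace X] {D : Measure X} [IsProbabilityMeasure D] {d n : ℕ}
  {P : Fin d → Set X} {v : Fin d → X → ℝ}

theorem measurableSet_isRetained (hP : ∀ i, MeasurableSet (P i)) (hvm : ∀ i, Measurable (v i))
    (T : Fin d → ℝ) : MeasurableSet {c | IsRetained P v T c} := by
  have : {c | IsRetained P v T c} = ⋃ i, P i ∩ {c | T i ≤ v i c} := by
    ext c; simp [IsRetained]
  rw [this]
  exact MeasurableSet.iUnion fun i => (hP i).inter (measurableSet_le measurable_const (hvm i))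

/-- A strict superlevel set is a finite union, over slot assignments, of the events that the
assignment is valid and exceeds the level. -/
theorem measurable_partialValue (hP : ∀ i, MeasurableSet (P i)) (hvm : ∀ i, Measurable (v i))
    (κ : Fin d → ℕ) (T : Fin d → ℝ) (A : Set (Fin n)) :
    Measurable fun C : Fin n → X => partialValue P v κ T C A := by
  refine measurable_of_Ioi fun r => ?_
  have hset : (fun C : Fin n → X => partialValue P v κ T C A) ⁻¹' Set.Ioi r =
      ⋃ m : (Σ i, Fin (κ i)) → Fin n ⊕ Fin (∑ i, κ i),
        {C | IsSlotSolution P κ C (A ∩ {j | IsRetained P v T (C j)}) m} ∩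
          {C | r < ∑ s, itemValue v C s.1 (m s)} := by
    ext C
    simp only [Set.mem_preimage, Set.mem_Ioi, Set.mem_iUnion, Set.mem_inter_iff,
      Set.mem_ofPred_eq]
    constructor
    · intro h
      obtain ⟨m, hm, e⟩ := exists_isSlotSolution_eq_optValue P v κ C
        (A ∩ {j | IsRetained P v T (C j)})
      exact ⟨m, hm, by rw [e]; exact h⟩
    · rintro ⟨m, hm, h⟩
      exact h.trans_le hm.le_optValue
  rw [hset]
  refine MeasurableSet.iUnion fun m => MeasurableSet.inter ?_ ?_
  · have : {C : Fin n → X | IsSlotSolution P κ C (A ∩ {j | IsRetained P v T (C j)}) m} =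
        {C | Function.Injective m} ∩ ((⋂ s, {C | HasProperty P C s.1 (m s)}) ∩
          ⋂ s, ⋂ j, {C | m s = Sum.inl j → j ∈ A ∧ IsRetained P v T (C j)}) := by
      ext C
      simp only [Set.mem_inter_iff, Set.mem_iInter, Set.mem_ofPred_eq]
      exact ⟨fun h => ⟨h.1, h.2, h.3⟩, fun h => ⟨h.1, h.2.1, h.2.2⟩⟩
    rw [this]
    refine (MeasurableSet.const _).inter ((MeasurableSet.iInter fun s => ?_).inter
      (MeasurableSet.iInter fun s => MeasurableSet.iInter fun j => ?_))
    · rcases m s with j | l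
      · exact (measurable_pi_apply j) (hP s.1)
      · exact MeasurableSet.const True
    · by_cases h : m s = Sum.inl j
      · simp only [h, true_imp_iff]
        have hj : Measurable fun C : Fin n → X => C j := measurable_pi_apply j
        exact (MeasurableSet.const (j ∈ A)).inter (hj (measurableSet_isRetained hP hvm T))
      · simp [h]
  · refine measurableSet_lt measurable_const (Finset.measurable_sum _ fun s _ => ?_)
    rcases m s with j | l
    · exact (hvm s.1).comp (measurable_pi_apply j)
    · exact measurable_const

theorem measurable_policyValue (hP : ∀ i, MeasurableSet (P i)) (hvm : ∀ i, Measurable (v i))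
    (κ : Fin d → ℕ) (T : Fin d → ℝ) :
    Measurable fun C : Fin n → X => policyValue P v κ T C := by
  simpa only [partialValue_univ] using measurable_partialValue (n := n) hP hvm κ T Set.univ

theorem isSubmodularFunctional_partialValue (hP : ∀ i, MeasurableSet (P i))
    (hvm : ∀ i, Measurable (v i)) (hv : ∀ i, ∀ c ∈ P i, v i c ∈ Set.Icc (0 : ℝ) 1)
    (κ : Fin d → ℕ) (T : Fin d → ℝ) :
    IsSubmodularFunctional (∑ i, κ i : ℕ) fun (C : Fin n → X) A => partialValue P v κ T C A where
  measurable A := measurable_partialValue hP hvm κ T A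
  bound C A := by
    have := optValue_mem_Icc hv κ C (A ∩ {j | IsRetained P v T (C j)})
    rw [partialValue, abs_of_nonneg this.1]
    exact this.2
  mono C A A' h := optValue_mono P v κ C (Set.inter_subset_inter_left _ h)
  union_add_inter_le C A A' := by
    have := optValue_union_add_inter_le P v κ C (A ∩ {j | IsRetained P v T (C j)})
      (A' ∩ {j | IsRetained P v T (C j)})
    rwa [← Set.union_inter_distrib_right, ← Set.inter_inter_distrib_right] at this
  insert_le C A j := by
    refine le_trans (optValue_mono P v κ C ?_) (optValue_insert_le hv κ C _ j)
    rintro x ⟨rfl | hx, hr⟩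
    exacts [Or.inl rfl, Or.inr ⟨hx, hr⟩]
  congr C C' A h := by
    have : A ∩ {j | IsRetained P v T (C j)} = A ∩ {j | IsRetained P v T (C' j)} := by
      ext j
      simp only [Set.mem_inter_iff, Set.mem_ofPred_eq, and_congr_right_iff]
      intro hj
      rw [h j hj]
    simp only [partialValue]
    rw [this]
    exact optValue_congr P v κ fun j hj => h j hj.1

instance isProbabilityMeasure_sampleLaw : IsProbabilityMeasure (sampleLaw D n) := by
  unfold sampleLaw; infer_instance

theorem integrable_policyValue (hP : ∀ i, MeasurableSet (P i)) (hvm : ∀ i, Measurable (v i))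
    (hv : ∀ i, ∀ c ∈ P i, v i c ∈ Set.Icc (0 : ℝ) 1) (κ : Fin d → ℕ) (T : Fin d → ℝ) :
    Integrable (fun C => policyValue P v κ T C) (sampleLaw D n) :=
  integrable_of_abs_le (measurable_policyValue hP hvm κ T) (B := (∑ i, κ i : ℕ)) fun C => by
    have := policyValue_mem_Icc hv κ T C
    rw [abs_of_nonneg this.1]
    exact this.2

theorem expectedPolicyValue_mem_Icc (hP : ∀ i, MeasurableSet (P i))
    (hvm : ∀ i, Measurable (v i)) (hv : ∀ i, ∀ c ∈ P i, v i c ∈ Set.Icc (0 : ℝ) 1)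
    (κ : Fin d → ℕ) (T : Fin d → ℝ) :
    expectedPolicyValue D n P v κ T ∈ Set.Icc (0 : ℝ) (∑ i, κ i : ℕ) := by
  refine ⟨integral_nonneg fun C => (policyValue_mem_Icc hv κ T C).1, ?_⟩
  have := integral_mono (integrable_policyValue (D := D) (n := n) hP hvm hv κ T)
    (integrable_const _) fun C => (policyValue_mem_Icc hv κ T C).2
  rwa [integral_const, probReal_univ, one_smul] at this

theorem expectedPolicyValue_antitone (hP : ∀ i, MeasurableSet (P i))
    (hvm : ∀ i, Measurable (v i)) (hv : ∀ i, ∀ c ∈ P i, v i c ∈ Set.Icc (0 : ℝ) 1)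
    (κ : Fin d → ℕ) : Antitone (expectedPolicyValue D n P v κ) := fun T T' h =>
  integral_mono (integrable_policyValue hP hvm hv κ T') (integrable_policyValue hP hvm hv κ T)
    fun C => policyValue_antitone P v κ C h

theorem expectedPolicyValue_sub_le (hP : ∀ i, MeasurableSet (P i))
    (hvm : ∀ i, Measurable (v i)) (hv : ∀ i, ∀ c ∈ P i, v i c ∈ Set.Icc (0 : ℝ) 1)
    (κ : Fin d → ℕ) {T T' : Fin d → ℝ} (h : T ≤ T') :
    expectedPolicyValue D n P v κ T - expectedPolicyValue D n P v κ T' ≤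
      ∑ i, (expectedPolicyValue D n P v κ (Function.update (fun _ => 2) i (T i)) -
        expectedPolicyValue D n P v κ (Function.update (fun _ => 2) i (T' i))) := by
  have hint := fun T => integrable_policyValue (D := D) (n := n) hP hvm hv κ T
  simp only [expectedPolicyValue]
  simp only [← integral_sub (hint _) (hint _)]
  have hi : ∀ i ∈ Finset.univ, Integrable (fun C : Fin n → X =>
      policyValue P v κ (Function.update (fun _ => 2) i (T i)) C -
        policyValue P v κ (Function.update (fun _ => 2) i (T' i)) C) (sampleLaw D n) :=
    fun i _ => (hint _).sub (hint _)
  rw [← integral_finsetSum _ hi]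
  exact integral_mono ((hint T).sub (hint T')) (integrable_finsetSum _ hi)
    fun C => policyValue_sub_le hv κ C h

theorem measure_abs_expectedPolicyValue_sub_ge_le (hP : ∀ i, MeasurableSet (P i))
    (hvm : ∀ i, Measurable (v i)) (hv : ∀ i, ∀ c ∈ P i, v i c ∈ Set.Icc (0 : ℝ) 1)
    {κ : Fin d → ℕ} {k : ℕ} (hκ : ∑ i, κ i = k) (hk : 0 < k) (T : Fin d → ℝ) {s : ℝ}
    (hs : 0 ≤ s) (hsk : s ≤ 2 * k) :
    (sampleLaw D n).real
      {C | s ≤ |expectedPolicyValue D n P v κ T - policyValue P v κ T C|} ≤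
      2 * Real.exp (-(s ^ 2 / (16 * k))) := by
  have h := (isSubmodularFunctional_partialValue (n := n) hP hvm hv κ T).measure_abs_sub_ge_le
    (D := D) (k := k) (by exact_mod_cast hk) (fun C => ?_) hs hsk
  · simp only [partialValue_univ] at h
    exact h
  · have h1 := (optValue_mem_Icc hv κ C (Set.univ ∩ {j | IsRetained P v T (C j)})).2
    have h2 := (optValue_mem_Icc hv κ C (∅ ∩ {j | IsRetained P v T (C j)})).1
    rw [hκ] at h1
    simp only [partialValue]
    linarith

/-- Without atoms, the expected value depends continuously on the thresholds. -/
theorem continuous_expectedPolicyValue (hP : ∀ i, MeasurableSet (P i))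
    (hvm : ∀ i, Measurable (v i)) (hv : ∀ i, ∀ c ∈ P i, v i c ∈ Set.Icc (0 : ℝ) 1)
    (hatom : ∀ i, ∀ x ∈ Set.Icc (0 : ℝ) 1, (D[|P i]) {c | v i c = x} = 0) (κ : Fin d → ℕ) :
    Continuous (expectedPolicyValue D n P v κ) := by
  rw [continuous_iff_continuousAt]
  intro T
  have hnull : ∀ i, ∀ᵐ c ∂D, c ∈ P i → v i c ≠ T i := by
    intro i
    by_cases hT : T i ∈ Set.Icc (0 : ℝ) 1
    · have h := hatom i _ hT
      rw [cond_apply (hP i), mul_eq_zero] at h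
      -- The inverse of a finite mass is never 0; when `P i` is null it is `∞`, so that case needs
      -- no separate treatment.
      have h0 := h.resolve_left (by simp)
      rw [ae_iff]
      refine measure_mono_null ?_ h0
      intro c hc
      simpa using hc
    · exact ae_of_all _ fun c hc h => hT (h ▸ hv i c hc)
  have hnull' : ∀ᵐ C ∂(sampleLaw D n), ∀ j i, C j ∈ P i → v i (C j) ≠ T i := by
    rw [ae_all_iff]
    intro j
    exact (measurePreserving_eval (fun _ : Fin n => D) j).quasiMeasurePreserving.ae
      (ae_all_iff.2 hnull)
  refine continuousAt_of_dominated (F := fun T C => policyValue P v κ T C)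
    (bound := fun _ => ((∑ i, κ i : ℕ) : ℝ))
    (Filter.Eventually.of_forall fun T =>
      (measurable_policyValue hP hvm κ T).aestronglyMeasurable)
    (Filter.Eventually.of_forall fun T => ae_of_all _ fun C => ?_) (integrable_const _) ?_
  · have := policyValue_mem_Icc hv κ T C
    rw [Real.norm_eq_abs, abs_of_nonneg this.1]
    exact this.2
  -- Almost surely no item sits exactly at its threshold, so the retained set is locally constant in
  -- the thresholds; dominated convergence does the rest.
  · filter_upwards [hnull'] with C hC
    have hev : ∀ᶠ T' in nhds T, ∀ j i, C j ∈ P i → (T' i ≤ v i (C j) ↔ T i ≤ v i (C j)) := by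
      rw [Filter.eventually_all]
      intro j
      rw [Filter.eventually_all]
      intro i
      by_cases hji : C j ∈ P i
      · have hcont : Filter.Tendsto (fun T' : Fin d → ℝ => T' i) (nhds T) (nhds (T i)) :=
          (continuous_apply i).tendsto T
        rcases lt_or_gt_of_ne (hC j i hji) with h | h
        · filter_upwards [hcont.eventually_const_lt h] with T' hT' _
          exact ⟨fun h' => absurd h' hT'.not_ge, fun h' => absurd h' h.not_ge⟩
        · filter_upwards [hcont.eventually_lt_const h] with T' hT' _
          exact ⟨fun _ => h.le, fun _ => hT'.le⟩
      · exact Filter.Eventually.of_forall fun _ h => absurd h hji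
    refine Filter.EventuallyEq.continuousAt (y := policyValue P v κ T C) ?_
    filter_upwards [hev] with T' hT'
    have : {j | IsRetained P v T' (C j)} = {j | IsRetained P v T (C j)} := by
      ext j
      exact exists_congr fun i => and_congr_right (hT' j i)
    simp only [policyValue, this]

/-- The range of a continuous function on `[0, 2]` with values in `[0, k]` can be bracketed by
`k + 1` points such that consecutive values differ by at most `1`. -/
theorem exists_bracketing {g : ℝ → ℝ} (hg : Continuous g) {k : ℕ} (hk : 0 < k)
    (hgk : ∀ t, g t ∈ Set.Icc (0 : ℝ) k) (hanti : Antitone g) :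
    ∃ G : Finset ℝ, G.card ≤ k + 1 ∧
      ∀ t ∈ Set.Icc (0 : ℝ) 2, ∃ a ∈ G, ∃ b ∈ G, a ≤ t ∧ t ≤ b ∧ g a - g b ≤ 1 := by
  classical
  have hk' : (0 : ℝ) < k := by exact_mod_cast hk
  have hg02 : g 2 ≤ g 0 := hanti (by norm_num)
  -- Preimages of `k + 1` equally spaced levels. The ends are pinned to 2 and 0 so that the brackets
  -- cover `[0, 2]`; the value 0 for `m > k` is a dummy.
  have hex : ∀ m : ℕ, ∃ t : ℝ, (m = 0 → t = 2) ∧ (m = k → t = 0) ∧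
      (m ≤ k → g t = g 2 + (g 0 - g 2) * (m / k)) := by
    intro m
    rcases Nat.eq_zero_or_pos m with rfl | hm
    · exact ⟨2, fun _ => rfl, fun h => absurd h hk.ne, fun _ => by simp⟩
    rcases eq_or_ne m k with rfl | hmk
    · exact ⟨0, fun h => absurd h hk.ne', fun _ => rfl, fun _ => by
        rw [div_self hk'.ne']; ring⟩
    by_cases hle : m ≤ k
    · have hq0 : (0 : ℝ) ≤ m / k := by positivity
      have hq1 : (m : ℝ) / k ≤ 1 := by
        rw [div_le_one hk']; exact_mod_cast hle
      have hmem : g 2 + (g 0 - g 2) * (m / k) ∈ Set.Icc (g 2) (g 0) :=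
        ⟨by nlinarith, by nlinarith⟩
      obtain ⟨t, -, ht⟩ := intermediate_value_Icc' (by norm_num : (0 : ℝ) ≤ 2)
        hg.continuousOn hmem
      exact ⟨t, fun h => absurd h hm.ne', fun h => absurd h hmk, fun _ => ht⟩
    · exact ⟨0, fun h => absurd h hm.ne', fun h => absurd h hmk, fun h => absurd h hle⟩
  choose t ht0 htk ht using hex
  refine ⟨(Finset.range (k + 1)).image t, Finset.card_image_le.trans (by simp), ?_⟩
  intro x hx
  have hP0 : x ≤ t 0 := by rw [ht0 0 rfl]; exact hx.2
  set m := Nat.findGreatest (fun m => x ≤ t m) (k - 1) with hm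
  have hmle : m ≤ k - 1 := Nat.findGreatest_le _
  have hxm : x ≤ t m := Nat.findGreatest_spec (P := fun m => x ≤ t m) (Nat.zero_le _) hP0
  have hmx : t (m + 1) ≤ x := by
    rcases eq_or_ne (m + 1) k with h | h
    · rw [htk _ h]; exact hx.1
    · exact (not_le.1 (Nat.findGreatest_is_greatest (P := fun m => x ≤ t m) (n := k - 1)
        (k := m + 1) (by omega) (by omega))).le
  refine ⟨t (m + 1), Finset.mem_image_of_mem _ (by simp; omega), t m,
    Finset.mem_image_of_mem _ (by simp; omega), hmx, hxm, ?_⟩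
  rw [ht _ (by omega), ht _ (by omega)]
  have h1 : g 0 - g 2 ≤ k := by linarith [(hgk 0).2, (hgk 2).1]
  have : g 2 + (g 0 - g 2) * ((m + 1 : ℕ) / k) - (g 2 + (g 0 - g 2) * (m / k)) =
      (g 0 - g 2) / k := by
    push_cast; field_simp; ring
  rw [this, div_le_one hk']
  exact h1

/-- The net is the product of the one-property grids. Every clipped policy lies coordinatewise
between two net policies whose expectations differ by at most `d`, and both the value and its
expectation are antitone. -/
theorem exists_policy_net (hP : ∀ i, MeasurableSet (P i))
    (hvm : ∀ i, Measurable (v i)) (hv : ∀ i, ∀ c ∈ P i, v i c ∈ Set.Icc (0 : ℝ) 1)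
    (hatom : ∀ i, ∀ x ∈ Set.Icc (0 : ℝ) 1, (D[|P i]) {c | v i c = x} = 0) {κ : Fin d → ℕ}
    {k : ℕ} (hκ : ∑ i, κ i = k) (hk : 0 < k) :
    ∃ N : Finset (Fin d → ℝ), N.card ≤ (k + 1) ^ d ∧ ∀ (C : Fin n → X) (s : ℝ),
      (∀ T ∈ N, |expectedPolicyValue D n P v κ T - policyValue P v κ T C| ≤ s) →
      ∀ T, |expectedPolicyValue D n P v κ T - policyValue P v κ T C| ≤ s + d := by
  classical
  have hbr := fun i : Fin d => exists_bracketing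
    (g := fun t => expectedPolicyValue D n P v κ (Function.update (fun _ => 2) i t))
    ((continuous_expectedPolicyValue hP hvm hv hatom κ).comp
      (continuous_const.update i continuous_id)) hk
    (fun t => hκ ▸ expectedPolicyValue_mem_Icc hP hvm hv κ _)
    (fun t t' h => expectedPolicyValue_antitone hP hvm hv κ (Function.update_mono h))
  choose G hGcard hG using hbr
  refine ⟨Fintype.piFinset G, ?_, ?_⟩
  · rw [Fintype.card_piFinset]
    refine (Finset.prod_le_prod' fun i _ => hGcard i).trans ?_
    simp
  · intro C s hs T
    have hclip : expectedPolicyValue D n P v κ (fun i => max 0 (min 2 (T i))) =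
        expectedPolicyValue D n P v κ T := by
      simp only [expectedPolicyValue, policyValue_clip hv]
    rw [← policyValue_clip hv κ T C, ← hclip]
    set T' : Fin d → ℝ := fun i => max 0 (min 2 (T i))
    have hT' : ∀ i, T' i ∈ Set.Icc (0 : ℝ) 2 := fun i =>
      ⟨le_max_left _ _, max_le (by norm_num) (min_le_left _ _)⟩
    choose a ha b hb haT hTb hab using fun i => hG i (T' i) (hT' i)
    have h1 := abs_le.1 (hs a (Fintype.mem_piFinset.2 ha))
    have h2 := abs_le.1 (hs b (Fintype.mem_piFinset.2 hb))
    have h3 : expectedPolicyValue D n P v κ a - expectedPolicyValue D n P v κ b ≤ d := by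
      refine (expectedPolicyValue_sub_le hP hvm hv κ fun i => (haT i).trans (hTb i)).trans ?_
      refine (Finset.sum_le_sum fun i _ => hab i).trans ?_
      simp
    have h4 := policyValue_antitone P v κ C (show a ≤ T' from haT)
    have h5 := policyValue_antitone P v κ C (show T' ≤ b from hTb)
    have h6 := expectedPolicyValue_antitone (D := D) (n := n) hP hvm hv κ (show a ≤ T' from haT)
    have h7 := expectedPolicyValue_antitone (D := D) (n := n) hP hvm hv κ (show T' ≤ b from hTb)
    simp only at h4 h5
    rw [abs_le]
    constructor <;> linarith [h1.1, h1.2, h2.1, h2.2]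

end Policies

end ThresholdSelection

/-! ### Choice of constants and union bound. -/

theorem mainTheorem5 :
    ∃ K : ℝ, 0 < K ∧
      ∀ (X : Type*) [MeasurableSpace X] (D : Measure X) [IsProbabilityMeasure D]
        (d n k : ℕ) (P : Fin d → Set X) (v : Fin d → X → ℝ) (κ : Fin d → ℕ) (δ : ℝ),
        (∀ i, MeasurableSet (P i)) →
        (∀ i, Measurable (v i)) →
        (∀ i, ∀ c ∈ P i, v i c ∈ Set.Icc (0 : ℝ) 1) →
        (∀ i, ∀ x ∈ Set.Icc (0 : ℝ) 1, (D[|P i]) {c | v i c = x} = 0) →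
        ∑ i, κ i = k →
        2 ≤ k →
        0 < δ → δ < 1 →
        (∀ T : Fin d → ℝ,
          Integrable (fun C => ThresholdSelection.policyValue P v κ T C)
            (ThresholdSelection.sampleLaw D n)) ∧
        ∃ E : Set (Fin n → X), MeasurableSet E ∧
          ENNReal.ofReal (1 - δ) ≤ ThresholdSelection.sampleLaw D n E ∧
          ∀ C ∈ E, ∀ T : Fin d → ℝ,
            |ThresholdSelection.expectedPolicyValue D n P v κ T
                - ThresholdSelection.policyValue P v κ T C|
              ≤ K * Real.sqrt ((d * Real.log k + Real.log (1 / δ)) / k) * k := by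
  open ThresholdSelection in
  -- With `q = √(kL)`, the deviation on the net costs `7q` and the passage to all policies costs `d
  -- ≤ 2q`.
  refine ⟨9, by norm_num, ?_⟩
  intro X _ D _ d n k P v κ δ hP hvm hv hatom hκ hk hδ hδ1
  refine ⟨integrable_policyValue hP hvm hv κ, ?_⟩
  have hk2 : (2 : ℝ) ≤ k := by exact_mod_cast hk
  have hk0 : (0 : ℝ) < k := by linarith
  have hd : 0 < d := by
    rcases Nat.eq_zero_or_pos d with rfl | h
    · simp at hκ; omega
    · exact h
  set L : ℝ := d * Real.log k + Real.log (1 / δ) with hL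
  have hlogδ : 0 ≤ Real.log (1 / δ) := Real.log_nonneg (by rw [le_div_iff₀ hδ]; linarith)
  have hlogk : 1 / 2 ≤ Real.log k :=
    le_trans (by linarith [Real.log_two_gt_d9]) (Real.log_le_log (by norm_num) hk2)
  have hdL : (d : ℝ) * (1 / 2) ≤ L := by
    have : (d : ℝ) * (1 / 2) ≤ d * Real.log k := by gcongr
    linarith
  have hL0 : 0 ≤ L := le_trans (by positivity) hdL
  set q := Real.sqrt (k * L) with hq
  have hq0 : 0 ≤ q := Real.sqrt_nonneg _
  have hq2 : q ^ 2 = k * L := Real.sq_sqrt (by positivity)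
  have hrhs : 9 * Real.sqrt (L / k) * k = 9 * q := by
    have : L / k = (k * L) / k ^ 2 := by field_simp
    rw [this, Real.sqrt_div' _ (by positivity), Real.sqrt_sq hk0.le, mul_assoc,
      div_mul_cancel₀ _ hk0.ne']
  rw [hrhs]
  -- If `7q > 2k` the claim is trivial, since both quantities lie in `[0, k]`; otherwise `s = 7q` is
  -- in the range of the tail bound.
  rcases lt_or_ge (2 * (k : ℝ)) (7 * q) with hbig | hsmall
  · refine ⟨Set.univ, MeasurableSet.univ, ?_, fun C _ T => ?_⟩
    · rw [measure_univ]
      exact ENNReal.ofReal_le_one.2 (by linarith)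
    · have h1 := expectedPolicyValue_mem_Icc (D := D) (n := n) hP hvm hv κ T
      have h2 := policyValue_mem_Icc hv κ T C
      rw [hκ] at h1 h2
      rw [abs_le]
      constructor <;> linarith [h1.1, h1.2, h2.1, h2.2]
  obtain ⟨N, hN, hnet⟩ := exists_policy_net (n := n) hP hvm hv hatom hκ (by omega : 0 < k)
  have hmeas : ∀ T, MeasurableSet
      {C : Fin n → X | 7 * q ≤ |expectedPolicyValue D n P v κ T - policyValue P v κ T C|} :=
    fun T => measurableSet_le measurable_const
      ((measurable_policyValue hP hvm κ T).const_sub _).abs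
  let bad : Set (Fin n → X) :=
    ⋃ T ∈ N, {C | 7 * q ≤ |expectedPolicyValue D n P v κ T - policyValue P v κ T C|}
  have hbadm : MeasurableSet bad := Finset.measurableSet_biUnion N fun T _ => hmeas T
  have hdq : (d : ℝ) ≤ 2 * q := by
    have h49 : 49 * L ≤ 4 * k := by
      have : (7 * q) ^ 2 ≤ (2 * k) ^ 2 := by gcongr
      nlinarith
    have : (d : ℝ) ^ 2 ≤ (2 * q) ^ 2 := by nlinarith
    exact (sq_le_sq₀ (by positivity) (by positivity)).1 this
  refine ⟨badᶜ, hbadm.compl, ?_, fun C hC T => ?_⟩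
  · have hy0 : (2 : ℝ) ≤ (k : ℝ) ^ d := hk2.trans (le_self_pow₀ (by linarith) hd.ne')
    -- The exponent is `49/16 · L ≥ 3L`. Of the three factors `k^(-d)`, two pay for the net, as `k +
    -- 1 ≤ k²`, and the third for the factor 2 of the two-sided tail.
    have hexp : Real.exp (-((7 * q) ^ 2 / (16 * k))) ≤ (δ / (k : ℝ) ^ d) ^ 3 := by
      have h1 : Real.exp (-L) = δ / (k : ℝ) ^ d := by
        rw [hL, neg_add, Real.exp_add, Real.exp_neg, Real.exp_neg, Real.exp_log (by positivity),
          mul_comm (d : ℝ), Real.exp_mul, Real.exp_log hk0, Real.rpow_natCast]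
        field_simp
      rw [← h1, ← Real.exp_nat_mul, Real.exp_le_exp, mul_pow, hq2]
      have : (7 : ℝ) ^ 2 * (k * L) / (16 * k) = 49 / 16 * L := by field_simp; ring
      rw [this]
      push_cast
      linarith
    have hcard : (N.card : ℝ) ≤ ((k : ℝ) ^ d) ^ 2 := by
      calc (N.card : ℝ) ≤ ((k + 1 : ℕ) ^ d : ℕ) := by exact_mod_cast hN
        _ = ((k : ℝ) + 1) ^ d := by push_cast; rfl
        _ ≤ ((k : ℝ) ^ 2) ^ d := by gcongr; nlinarith
        _ = _ := by rw [← pow_mul, ← pow_mul, mul_comm]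
    have hbad : (sampleLaw D n).real bad ≤ δ := by
      calc (sampleLaw D n).real bad ≤ ∑ T ∈ N, (sampleLaw D n).real
            {C | 7 * q ≤ |expectedPolicyValue D n P v κ T - policyValue P v κ T C|} :=
          measureReal_biUnion_finset_le _ _
        _ ≤ ∑ T ∈ N, 2 * (δ / (k : ℝ) ^ d) ^ 3 := Finset.sum_le_sum fun T _ =>
          (measure_abs_expectedPolicyValue_sub_ge_le hP hvm hv hκ (by omega) T (by positivity)
            hsmall).trans (by gcongr)
        _ = N.card * (2 * (δ / (k : ℝ) ^ d) ^ 3) := by rw [Finset.sum_const, nsmul_eq_mul]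
        _ ≤ ((k : ℝ) ^ d) ^ 2 * (2 * (δ / (k : ℝ) ^ d) ^ 3) := by gcongr
        _ = δ ^ 3 * (2 / (k : ℝ) ^ d) := by field_simp
        _ ≤ δ ^ 3 * 1 := by gcongr; rw [div_le_one (by positivity)]; exact hy0
        _ ≤ δ := by rw [mul_one]; exact pow_le_of_le_one hδ.le hδ1.le (by norm_num)
    rw [← ofReal_measureReal (measure_ne_top _ _), probReal_compl_eq_one_sub hbadm]
    exact ENNReal.ofReal_le_ofReal (by linarith)
  · refine (hnet C (7 * q) (fun T hT => ?_) T).trans (by linarith)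
    by_contra h
    exact hC (Set.mem_biUnion hT (not_le.1 h).le)
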